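/- Online strategic classification. Let $\mathcal X$ be a set (the feature space), $\mathcal Y=\{-1,+1\}$, let $G$ be a directed graph on $\mathcal X$, and let $N_G[x]$ consist of $x$ and its out-neighbours. For $h\in\mathcal Y^{\mathcal X}$ let $\mathrm{BR}_{G,h}(x)=\{x'\in N_G[x] : h(x')=+1\}$. In response to $h$, an agent $(x,y)\in\mathcal X\times\mathcal Y$ moves to the point $z$ with $z=x$ if $\mathrm{BR}_{G,h}(x)=\emptyset$ or $x\in \mathrm{BR}_{G,h}(x)$, and otherwise $z\in\mathrm{BR}_{G,h}(x)$ is selected by a fixed tie-breaking rule; the strategic loss is $\ell(h,(x,y))=\mathbf 1\{h(z)\ne y\}$. In each round $t=1,\dots,T$ a learner chooses a probability distribution $\mathcal D_t$ on $\mathcal Y^{\mathcal X}$ as a function of its past observations $(h_s,z_s,y_s)_{s<t}$; simultaneously an adaptive, possibly randomized adversary chooses an agent $(x_t,y_t)$ on the basis of the learner's algorithm and the complete history $(h_s,x_s,y_s,z_s)_{s<t}$; then $h_t\sim\mathcal D_t$ is drawn, independently of $(x_t,y_t)$ given the past, the agent moves to $z_t$ in response to $h_t$, and the learner observes $z_t$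 and $y_t$ (but not $x_t$). All random choices follow discrete distributions. For a finite nonempty class $\mathcal H\subseteq\mathcal Y^{\mathcal X}$ the expected (Stackelberg) regret is $$\mathbb E[\mathfrak R_T]=\max_{h\in\mathcal H}\sum_{t=1}^T\mathbb E\big[\ell(h_t,(x_t,y_t))-\ell(h,(x_t,y_t))\big].$$ **Corollary.** There is an absolute constant $C>0$ such that for every $\mathcal X$, every directed graph $G$ on $\mathcal X$, every finite nonempty $\mathcal H\subseteq\mathcal Y^{\mathcal X}$ of size $n$ and every horizon $T\ge 1$ there is an improper learner (that is, one allowed to play arbitrary classifiers in $\mathcal Y^{\mathcal X}$, not only those in $\mathcal H$) which guarantees, for every tie-breaking rule and against every adaptive adversary, $$\mathbb E[\mathfrak R_T]\;\le\; C\,\min\Big\{\sqrt{T\log n}+n\log(nT),\; T^{3/4}\big(\log(nT)\big)^{1/4}\Big\}.$$ -/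

import Mathlib

/-! Online strategic classification with post-manipulation feedback.

Labels are `Bool`, with `true` for `+1` and `false` for `-1`. -/

namespace OnlineStrategic

noncomputable section

/-- A binary classifier on the feature space `X`, i.e. an element of `Y ^ X`. -/
abbrev Classifier (X : Type*) := X → Bool

/-- An agent: the true feature vector together with the true label. -/
abbrev Agent (X : Type*) := X × Bool

/-- The closed out-neighborhood `N_G[x]` of `x` in the manipulation graph. -/
def closedNbhd {X : Type*} (G : Digraph X) (x : X) : Set X :=
  {x' | x' = x ∨ G.Adj x x'}

/-- The set of best responses of `x` to the classifier `h`. -/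
def bestResponses {X : Type*} (G : Digraph X) (h : Classifier X) (x : X) : Set X :=
  {x' | x' ∈ closedNbhd G x ∧ h x' = true}

/-- A manipulation rule: best responding with an arbitrary, but fixed, tie-breaking. The agent
stays put if it has no best response or is itself a best response; otherwise it moves to some
best response. -/
structure ManipulationRule {X : Type*} (G : Digraph X) where
  move : Classifier X → X → X
  stay : ∀ h x, bestResponses G h x = ∅ ∨ x ∈ bestResponses G h x → move h x = x
  best : ∀ h x, ¬ (bestResponses G h x = ∅ ∨ x ∈ bestResponses G h x) →
    move h x ∈ bestResponses G h x

/-- The strategic loss of `h` at the agent `a`: whether `h` errs at the manipulated feature. -/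
def strategicLoss {X : Type*} {G : Digraph X} (ρ : ManipulationRule G)
    (h : Classifier X) (a : Agent X) : ℝ :=
  if h (ρ.move h a.1) ≠ a.2 then 1 else 0

/-- Everything that happens in one round: the sampled classifier `h_t`, the agent `(x_t, y_t)`
and the manipulated feature `z_t`. -/
structure Round (X : Type*) where
  classifier : Classifier X
  agent : Agent X
  manipulated : X

/-- What the learner sees of one round: `h_t`, `z_t` and `y_t`, but not `x_t`. -/
structure Observation (X : Type*) where
  classifier : Classifier X
  manipulated : X
  label : Bool

/-- The learner's view of a round. -/
def Round.observe {X : Type*} (r : Round X) : Observation X :=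
  ⟨r.classifier, r.manipulated, r.agent.2⟩

/-- A (randomized, possibly improper) learner with post-manipulation feedback: its past
observations, in chronological order, determine the distribution of the next classifier, which
can be any classifier on `X`. -/
abbrev Learner (X : Type*) := List (Observation X) → PMF (Classifier X)

/-- A (possibly randomized) adaptive adversary: the complete history of the past rounds, in
chronological order, determines the distribution of the next agent. It knows the learner's
algorithm, hence its current distribution, but not the classifier about to be sampled. -/
abbrev Adversary (X : Type*) := List (Round X) → PMF (Agent X)

/-- The law of the history of the first `T` rounds of the interaction. In every round the
classifier and the agent are drawn independently given the past; then the agent manipulates. -/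
def play {X : Type*} {G : Digraph X} (ρ : ManipulationRule G)
    (L : Learner X) (A : Adversary X) : ℕ → PMF (List (Round X))
  | 0 => PMF.pure []
  | t + 1 => (play ρ L A t).bind fun past =>
      (L (past.map Round.observe)).bind fun h =>
        (A past).bind fun a =>
          PMF.pure (past ++ [⟨h, a, ρ.move h a.1⟩])

/-- Expectation of a real function under a discrete law. -/
def expectation {α : Type*} (p : PMF α) (f : α → ℝ) : ℝ :=
  ∑' a, (p a).toReal * f a

/-- The regret of the learner with respect to the fixed classifier `h`, along a history. -/
def regretAgainst {X : Type*} {G : Digraph X} (ρ : ManipulationRule G)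
    (h : Classifier X) (history : List (Round X)) : ℝ :=
  (history.map fun r => strategicLoss ρ r.classifier r.agent - strategicLoss ρ h r.agent).sum

/-- The expected Stackelberg regret after `T` rounds:
`max_{h ∈ H} E [∑_{t ≤ T} (loss of h_t - loss of h)]`. -/
def expectedRegret {X : Type*} {G : Digraph X} (ρ : ManipulationRule G)
    (H : Finset (Classifier X)) (hH : H.Nonempty)
    (L : Learner X) (A : Adversary X) (T : ℕ) : ℝ :=
  H.sup' hH fun h => expectation (play ρ L A T) (regretAgainst ρ h)

end

end OnlineStrategic

namespace OnlineStrategic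

noncomputable section

universe u

/-! ### Expectations under discrete laws -/

section Expectation

variable {α β : Type*}

/-! With `s = ±1` the label sign, the loss of `h` is `(1 - s)/2 + s * r_h(x)`, where `r_h(x)`
indicates that no best response to `h` is available at `x` (rejection). Up to a term common to all
classifiers, the loss is therefore `s * r_h(x)`. A rejected agent does not move, so the learner then
sees the true `x` and can evaluate `r_h(x)` for every `h` at once, whatever the tie-breaking rule.

The learner runs exponential weights on `s * r_h(x) / q`, charged only upon rejection, where `q` is
its own probability of rejecting `x`; this estimate is unbiased. Mixing in the all-negative
classifier with probability `η` forces `q ≥ η`, which keeps the exponents in `[-1, 1]`. The estimate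
vanishes on classifiers that accept `x`, so the second-order term is about `η * p / q`, where `p` is
the weight of the rejecting classifiers. Since `q ≥ (1 - η) * p`, this is at most `2 * η`, with no
dependence on the size `n` of the class.

Hence regret plus log-partition potential drifts by at most `3 * η` per round (`drift_le`), and the
regret is at most `log n / η + 3 * η * T`. Choosing `η = √(log n / T)` gives `4 * √(T log n)`, which
implies the first bound and, combined with the trivial bound `T`, the second. -/

theorem hasSum_toReal (p : PMF α) : HasSum (fun a => (p a).toReal) 1 := by
  have h := ENNReal.hasSum_toReal (f := fun a => p a) (by rw [p.tsum_coe]; exact ENNReal.one_ne_top)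
  rwa [← ENNReal.tsum_toReal_eq (fun a => p.apply_ne_top a), p.tsum_coe, ENNReal.toReal_one] at h

theorem toReal_eq_zero_of_notMem_support (p : PMF α) {a : α} (ha : a ∉ p.support) :
    (p a).toReal = 0 := by
  rw [PMF.apply_eq_zero_iff p a |>.2 ha, ENNReal.toReal_zero]

theorem summable_expectation (p : PMF α) {f : α → ℝ} {B : ℝ}
    (hf : ∀ a ∈ p.support, |f a| ≤ B) : Summable fun a => (p a).toReal * f a := by
  refine Summable.of_norm_bounded (g := fun a => (p a).toReal * B)
    ((hasSum_toReal p).summable.mul_right B) fun a => ?_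
  rw [Real.norm_eq_abs, abs_mul, abs_of_nonneg ENNReal.toReal_nonneg]
  by_cases ha : a ∈ p.support
  · exact mul_le_mul_of_nonneg_left (hf a ha) ENNReal.toReal_nonneg
  · simp [toReal_eq_zero_of_notMem_support p ha]

/-- The bounds on the support guarantee summability; a non-summable `tsum` would take the default
value `0`. -/
theorem expectation_mono (p : PMF α) {f g : α → ℝ} {B B' : ℝ}
    (hf : ∀ a ∈ p.support, |f a| ≤ B) (hg : ∀ a ∈ p.support, |g a| ≤ B')
    (h : ∀ a ∈ p.support, f a ≤ g a) : expectation p f ≤ expectation p g := by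
  refine (summable_expectation p hf).tsum_le_tsum (fun a => ?_) (summable_expectation p hg)
  by_cases ha : a ∈ p.support
  · exact mul_le_mul_of_nonneg_left (h a ha) ENNReal.toReal_nonneg
  · simp [toReal_eq_zero_of_notMem_support p ha]

theorem expectation_const (p : PMF α) (c : ℝ) : expectation p (fun _ => c) = c := by
  rw [expectation, ((hasSum_toReal p).mul_right c).tsum_eq, one_mul]

theorem expectation_add_const (p : PMF α) {f : α → ℝ} {B : ℝ}
    (hf : ∀ a ∈ p.support, |f a| ≤ B) (c : ℝ) :
    expectation p (fun a => f a + c) = expectation p f + c := by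
  unfold expectation
  simp only [mul_add]
  rw [(summable_expectation p hf).tsum_add ((hasSum_toReal p).summable.mul_right c),
    ((hasSum_toReal p).mul_right c).tsum_eq, one_mul]

theorem expectation_le_of_forall_le (p : PMF α) {f : α → ℝ} {B c : ℝ}
    (hf : ∀ a ∈ p.support, |f a| ≤ B) (h : ∀ a ∈ p.support, f a ≤ c) : expectation p f ≤ c :=
  (expectation_mono p hf (fun _ _ => le_rfl) h).trans (expectation_const p c).le

theorem abs_expectation_le (p : PMF α) {f : α → ℝ} {B : ℝ}
    (hf : ∀ a ∈ p.support, |f a| ≤ B) : |expectation p f| ≤ B := by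
  refine abs_le.2 ⟨?_, expectation_le_of_forall_le p hf fun a ha => (abs_le.1 (hf a ha)).2⟩
  rw [← expectation_const p (-B)]
  exact expectation_mono p (fun _ _ => le_rfl) hf fun a ha => (abs_le.1 (hf a ha)).1

theorem expectation_pure (a : α) (f : α → ℝ) : expectation (PMF.pure a) f = f a := by
  unfold expectation
  rw [tsum_eq_single a fun b hb => by simp [PMF.pure_apply, hb]]
  simp

/-- Tower rule, by Fubini: the joint masses are summable and `f` is bounded wherever they are
nonzero. -/
theorem expectation_bind (p : PMF α) (k : α → PMF β) {f : β → ℝ} {B : ℝ}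
    (hf : ∀ a ∈ p.support, ∀ b ∈ (k a).support, |f b| ≤ B) :
    expectation (p.bind k) f = expectation p fun a => expectation (k a) f := by
  have hmul : ∀ b, ((p.bind k) b).toReal = ∑' a, (p a).toReal * (k a b).toReal := fun b => by
    rw [PMF.bind_apply, ENNReal.tsum_toReal_eq]
    · simp
    · exact fun a => ENNReal.mul_ne_top (p.apply_ne_top a) ((k a).apply_ne_top b)
  have hB : Summable fun x : α × β => (p x.1).toReal * (k x.1 x.2).toReal := by
    have hnonneg : 0 ≤ fun x : α × β => (p x.1).toReal * (k x.1 x.2).toReal := by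
      intro x
      dsimp only [Pi.zero_apply]
      positivity
    have hrow : ∀ a, Summable fun b => (p a).toReal * (k a b).toReal := fun a =>
      (hasSum_toReal (k a)).summable.mul_left (p a).toReal
    refine (summable_prod_of_nonneg hnonneg).2 ⟨hrow, ?_⟩
    have htsum : ∀ a, ∑' b, (p a).toReal * (k a b).toReal = (p a).toReal := fun a => by
      rw [tsum_mul_left, (hasSum_toReal (k a)).tsum_eq, mul_one]
    simpa only [htsum] using (hasSum_toReal p).summable
  have hs : Summable fun x : α × β => (p x.1).toReal * (k x.1 x.2).toReal * f x.2 := by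
    refine Summable.of_norm_bounded (hB.mul_right B) fun x => ?_
    rw [Real.norm_eq_abs, abs_mul,
      abs_of_nonneg (mul_nonneg ENNReal.toReal_nonneg ENNReal.toReal_nonneg)]
    by_cases h1 : x.1 ∈ p.support
    · by_cases h2 : x.2 ∈ (k x.1).support
      · exact mul_le_mul_of_nonneg_left (hf _ h1 _ h2)
          (mul_nonneg ENNReal.toReal_nonneg ENNReal.toReal_nonneg)
      · simp [toReal_eq_zero_of_notMem_support _ h2]
    · simp [toReal_eq_zero_of_notMem_support _ h1]
  unfold expectation
  calc ∑' b, ((p.bind k) b).toReal * f b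
      = ∑' b, ∑' a, (p a).toReal * (k a b).toReal * f b := by
        simp only [hmul, tsum_mul_right]
    _ = ∑' a, ∑' b, (p a).toReal * (k a b).toReal * f b :=
        Summable.tsum_comm (f := fun a b => (p a).toReal * (k a b).toReal * f b) hs
    _ = ∑' a, (p a).toReal * ∑' b, (k a b).toReal * f b := by
        simp only [mul_assoc, tsum_mul_left]

end Expectation

variable {X : Type u} {G : Digraph X}

/-! ### The interaction protocol -/

theorem length_of_mem_support_play (ρ : ManipulationRule G) (L : Learner X) (A : Adversary X) :
    ∀ (T : ℕ), ∀ l ∈ (play ρ L A T).support, l.length = T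
  | 0, l, hl => by
    rw [play, PMF.support_pure, Set.mem_singleton_iff] at hl
    simp [hl]
  | T + 1, l, hl => by
    simp only [play, PMF.mem_support_bind_iff, PMF.support_pure, Set.mem_singleton_iff] at hl
    obtain ⟨past, hpast, h, -, a, -, rfl⟩ := hl
    simp [length_of_mem_support_play ρ L A T past hpast]

/-- A function of the history whose expected increase in each round is at most `c`, whatever the
agent, increases in expectation by at most `c * T` over `T` rounds. -/
theorem expectation_play_le (ρ : ManipulationRule G) (L : Learner X) (A : Adversary X)
    {F : List (Round X) → ℝ} {B : ℕ → ℝ} {c : ℝ} (hB : ∀ l, |F l| ≤ B l.length)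
    (hstep : ∀ (past : List (Round X)) (a : Agent X),
      expectation (L (past.map Round.observe))
        (fun h => F (past ++ [⟨h, a, ρ.move h a.1⟩])) ≤ F past + c) :
    ∀ T : ℕ, expectation (play ρ L A T) F ≤ F [] + T * c
  | 0 => by simp [play, expectation_pure]
  | T + 1 => by
    have hlen := length_of_mem_support_play ρ L A T
    have hF : ∀ past ∈ (play ρ L A T).support, |F past| ≤ B T := fun past hpast => by
      simpa [hlen past hpast] using hB past
    have hF' : ∀ past ∈ (play ρ L A T).support, ∀ r, |F (past ++ [r])| ≤ B (T + 1) :=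
      fun past hpast r => by simpa [hlen past hpast] using hB (past ++ [r])
    have hinner : ∀ past ∈ (play ρ L A T).support,
        expectation ((L (past.map Round.observe)).bind fun h => (A past).bind fun a =>
          PMF.pure (past ++ [⟨h, a, ρ.move h a.1⟩])) F ≤ F past + c := fun past hpast => by
      have hsup : ∀ a h, ∀ l ∈ (PMF.pure (past ++ [⟨h, a, ρ.move h a.1⟩])).support,
          |F l| ≤ B (T + 1) := fun a h l hl => by
        rw [PMF.support_pure, Set.mem_singleton_iff] at hl
        exact hl ▸ hF' past hpast _
      have hbd : ∀ a, ∀ l ∈ ((L (past.map Round.observe)).bind fun h =>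
          PMF.pure (past ++ [⟨h, a, ρ.move h a.1⟩])).support, |F l| ≤ B (T + 1) := fun a l hl => by
        rw [PMF.mem_support_bind_iff] at hl
        obtain ⟨h, -, hl⟩ := hl
        exact hsup a h l hl
      -- Classifier and agent are independent given the past, so the agent can be drawn first and
      -- the one-round bound applied to each fixed agent.
      rw [PMF.bind_comm, expectation_bind _ _ fun a _ => hbd a]
      refine expectation_le_of_forall_le _ (fun a _ => abs_expectation_le _ (hbd a)) fun a _ => ?_
      rw [expectation_bind _ _ fun h _ => hsup a h]
      simpa only [expectation_pure] using hstep past a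
    have hbd : ∀ past ∈ (play ρ L A T).support, ∀ l ∈ ((L (past.map Round.observe)).bind fun h =>
        (A past).bind fun a => PMF.pure (past ++ [⟨h, a, ρ.move h a.1⟩])).support,
        |F l| ≤ B (T + 1) := fun past hpast l hl => by
      simp only [PMF.mem_support_bind_iff, PMF.support_pure, Set.mem_singleton_iff] at hl
      obtain ⟨h, -, a, -, rfl⟩ := hl
      exact hF' past hpast _
    rw [play, expectation_bind _ _ hbd]
    calc _ ≤ expectation (play ρ L A T) fun past => F past + c :=
          expectation_mono _ (fun past hpast => abs_expectation_le _ (hbd past hpast))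
            (fun past hpast => (abs_add_le _ _).trans (add_le_add_left (hF past hpast) |c|)) hinner
      _ = expectation (play ρ L A T) F + c := expectation_add_const _ hF c
      _ ≤ F [] + T * c + c := by
        have := expectation_play_le ρ L A hB hstep T
        linarith
      _ = F [] + (T + 1 : ℕ) * c := by push_cast; ring

theorem strategicLoss_mem_Icc (ρ : ManipulationRule G) (h : Classifier X) (a : Agent X) :
    strategicLoss ρ h a ∈ Set.Icc (0 : ℝ) 1 := by
  unfold strategicLoss
  split_ifs <;> simp

theorem regretAgainst_nil (ρ : ManipulationRule G) (h : Classifier X) :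
    regretAgainst ρ h [] = 0 := rfl

theorem regretAgainst_concat (ρ : ManipulationRule G) (h : Classifier X) (l : List (Round X))
    (r : Round X) : regretAgainst ρ h (l ++ [r]) =
      regretAgainst ρ h l + (strategicLoss ρ r.classifier r.agent - strategicLoss ρ h r.agent) := by
  simp [regretAgainst]

theorem abs_regretAgainst_le (ρ : ManipulationRule G) (h : Classifier X) (l : List (Round X)) :
    |regretAgainst ρ h l| ≤ l.length := by
  induction l using List.reverseRecOn with
  | nil => simp [regretAgainst_nil]
  | append_singleton l r ih =>
    obtain ⟨h1, h2⟩ := strategicLoss_mem_Icc ρ r.classifier r.agent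
    obtain ⟨h3, h4⟩ := strategicLoss_mem_Icc ρ h r.agent
    rw [regretAgainst_concat, List.length_append, List.length_singleton]
    push_cast
    rw [abs_le] at ih ⊢
    constructor <;> linarith [ih.1, ih.2]

theorem expectation_regretAgainst_le_horizon (ρ : ManipulationRule G) (L : Learner X)
    (A : Adversary X) (h : Classifier X) (T : ℕ) :
    expectation (play ρ L A T) (regretAgainst ρ h) ≤ T :=
  expectation_le_of_forall_le _ (B := T)
    (fun l hl => (abs_regretAgainst_le ρ h l).trans
      (by rw [length_of_mem_support_play ρ L A T l hl]))
    fun l hl => (le_abs_self _).trans <| (abs_regretAgainst_le ρ h l).trans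
      (by rw [length_of_mem_support_play ρ L A T l hl])

theorem expectation_regretAgainst_pure_le (ρ : ManipulationRule G) (A : Adversary X)
    (h : Classifier X) (T : ℕ) :
    expectation (play ρ (fun _ => PMF.pure h) A T) (regretAgainst ρ h) ≤ 0 := by
  simpa [regretAgainst_nil] using expectation_play_le ρ (fun _ => PMF.pure h) A (c := 0)
    (B := fun n => n) (abs_regretAgainst_le ρ h)
    (fun past a => by rw [expectation_pure, regretAgainst_concat]; simp) T

/-! ### The strategic loss in terms of rejection -/

/-- The indicator that an agent at `x` has no best response to `h`, hence ends up labelled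
negatively. -/
def rejection (G : Digraph X) (h : Classifier X) (x : X) : ℝ :=
  if bestResponses G h x = ∅ then 1 else 0

/-- The label as a sign. -/
def labelSign (y : Bool) : ℝ := if y then 1 else -1

theorem rejection_eq_zero_or_one (h : Classifier X) (x : X) :
    rejection G h x = 0 ∨ rejection G h x = 1 := by
  unfold rejection
  split_ifs <;> simp

theorem rejection_nonneg (h : Classifier X) (x : X) : 0 ≤ rejection G h x := by
  rcases rejection_eq_zero_or_one (G := G) h x with h | h <;> simp [h]

theorem rejection_le_one (h : Classifier X) (x : X) : rejection G h x ≤ 1 := by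
  rcases rejection_eq_zero_or_one (G := G) h x with h | h <;> simp [h]

theorem rejection_const_false (x : X) : rejection G (fun _ => false) x = 1 := by
  simp [rejection, bestResponses]

theorem move_eq_self_of_empty (ρ : ManipulationRule G) {h : Classifier X} {x : X}
    (hx : bestResponses G h x = ∅) : ρ.move h x = x := ρ.stay h x (Or.inl hx)

theorem apply_move_eq_false_of_empty (ρ : ManipulationRule G) {h : Classifier X} {x : X}
    (hx : bestResponses G h x = ∅) : h (ρ.move h x) = false := by
  rw [move_eq_self_of_empty ρ hx, Bool.eq_false_iff]
  exact fun hh => (hx ▸ (⟨Or.inl rfl, hh⟩ : x ∈ bestResponses G h x) : x ∈ (∅ : Set X))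

theorem apply_move_eq_true_of_nonempty (ρ : ManipulationRule G) {h : Classifier X} {x : X}
    (hx : bestResponses G h x ≠ ∅) : h (ρ.move h x) = true := by
  by_cases hm : x ∈ bestResponses G h x
  · rw [ρ.stay h x (Or.inr hm)]
    exact hm.2
  · exact (ρ.best h x (by tauto)).2

/-- The label assigned after manipulation is positive exactly when a best response exists, so
tie-breaking does not affect the loss. -/
theorem strategicLoss_eq (ρ : ManipulationRule G) (h : Classifier X) (a : Agent X) :
    strategicLoss ρ h a = (1 - labelSign a.2) / 2 + labelSign a.2 * rejection G h a.1 := by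
  obtain ⟨x, y⟩ := a
  by_cases hx : bestResponses G h x = ∅
  · cases y <;> norm_num [strategicLoss, labelSign, rejection, hx,
      apply_move_eq_false_of_empty ρ hx]
  · cases y <;> norm_num [strategicLoss, labelSign, rejection, hx,
      apply_move_eq_true_of_nonempty ρ hx]

theorem abs_labelSign (y : Bool) : |labelSign y| = 1 := by
  cases y <;> simp [labelSign]

/-! ### Exponential weights with exploration by the all-negative classifier -/

section ExponentialWeights

variable (G) (H : Finset (Classifier X)) (η : ℝ)

/-- The total weight of the class, given the cumulative estimated losses `R`. -/
def totalWeight (R : Classifier X → ℝ) : ℝ := ∑ h ∈ H, Real.exp (-η * R h)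

/-- The probability with which the exponential weights reject an agent at `x`. -/
def weightedRejection (R : Classifier X → ℝ) (x : X) : ℝ :=
  ∑ h ∈ H, Real.exp (-η * R h) / totalWeight H η R * rejection G h x

/-- The probability with which the learner rejects an agent at `x`. -/
def rejectionProb (R : Classifier X → ℝ) (x : X) : ℝ :=
  η + (1 - η) * weightedRejection G H η R x

/-- The update of the cumulative losses, relative to the all-positive classifier. Only rounds in
which the agent is rejected contribute: then the agent has not moved and its true feature is
observed. -/
def updateLosses (R : Classifier X → ℝ) (o : Observation X) : Classifier X → ℝ := fun h =>
  R h + if o.classifier o.manipulated then 0 else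
    labelSign o.label * rejection G h o.manipulated / rejectionProb G H η R o.manipulated

/-- The cumulative importance-weighted estimates of the relative losses. -/
def estimatedLosses (obs : List (Observation X)) : Classifier X → ℝ :=
  obs.foldl (updateLosses G H η) 0

/-- The mass that the learner gives to the all-negative classifier (`none`) and to the members of
the class. -/
def mixtureWeight (R : Classifier X → ℝ) : Option H → ℝ
  | none => η
  | some h => (1 - η) * (Real.exp (-η * R h) / totalWeight H η R)

/-- The classifier that corresponds to an outcome of the mixture. -/
def mixtureClassifier : Option H → Classifier X
  | none => fun _ => false
  | some h => h

/-- The potential: a normalized log-partition function, relative to the comparator `h`. -/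
def potential (h : Classifier X) (R : Classifier X → ℝ) : ℝ :=
  Real.log (totalWeight H η R) / η + R h

variable {H η}

theorem totalWeight_pos (hH : H.Nonempty) (R : Classifier X → ℝ) : 0 < totalWeight H η R :=
  Finset.sum_pos (fun _ _ => Real.exp_pos _) hH

theorem sum_weights_eq_one (hH : H.Nonempty) (R : Classifier X → ℝ) :
    ∑ h ∈ H, Real.exp (-η * R h) / totalWeight H η R = 1 := by
  rw [← Finset.sum_div]
  exact div_self (totalWeight_pos hH R).ne'

theorem weightedRejection_nonneg (hH : H.Nonempty) (R : Classifier X → ℝ) (x : X) :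
    0 ≤ weightedRejection G H η R x :=
  Finset.sum_nonneg fun _ _ => mul_nonneg
    (div_nonneg (Real.exp_pos _).le (totalWeight_pos hH R).le) (rejection_nonneg _ _)

theorem weightedRejection_le_one (hH : H.Nonempty) (R : Classifier X → ℝ) (x : X) :
    weightedRejection G H η R x ≤ 1 := by
  rw [← sum_weights_eq_one (η := η) hH R]
  exact Finset.sum_le_sum fun _ _ => mul_le_of_le_one_right
    (div_nonneg (Real.exp_pos _).le (totalWeight_pos hH R).le) (rejection_le_one _ _)

theorem mixtureWeight_nonneg (hH : H.Nonempty) (h0 : 0 ≤ η) (h1 : η ≤ 1)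
    (R : Classifier X → ℝ) (i : Option H) : 0 ≤ mixtureWeight H η R i := by
  cases i with
  | none => exact h0
  | some h =>
    exact mul_nonneg (sub_nonneg.2 h1)
      (div_nonneg (Real.exp_pos _).le (totalWeight_pos hH R).le)

theorem sum_mixtureWeight (hH : H.Nonempty) (R : Classifier X → ℝ) :
    ∑ i, mixtureWeight H η R i = 1 := by
  rw [Fintype.sum_option]
  simp only [mixtureWeight]
  rw [← Finset.mul_sum,
    Finset.sum_coe_sort H (fun h => Real.exp (-η * R h) / totalWeight H η R),
    sum_weights_eq_one hH]
  ring

/-- This makes division by `rejectionProb` the correct importance weighting. -/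
theorem sum_mixtureWeight_mul_rejection (R : Classifier X → ℝ) (x : X) :
    ∑ i, mixtureWeight H η R i * rejection G (mixtureClassifier H i) x =
      rejectionProb G H η R x := by
  rw [Fintype.sum_option]
  simp only [mixtureWeight, mixtureClassifier, rejection_const_false, mul_one, mul_assoc]
  rw [← Finset.mul_sum, Finset.sum_coe_sort H
    (fun h => Real.exp (-η * R h) / totalWeight H η R * rejection G h x)]
  rfl

/-- The law of the learner's classifier, given the cumulative estimated losses. -/
def mixture (hH : H.Nonempty) (h0 : 0 ≤ η) (h1 : η ≤ 1) (R : Classifier X → ℝ) :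
    PMF (Classifier X) :=
  (PMF.ofFintype (fun i => ENNReal.ofReal (mixtureWeight H η R i)) (by
    rw [← ENNReal.ofReal_sum_of_nonneg fun i _ => mixtureWeight_nonneg hH h0 h1 R i,
      sum_mixtureWeight hH, ENNReal.ofReal_one])).bind fun i => PMF.pure (mixtureClassifier H i)

theorem expectation_mixture (hH : H.Nonempty) (h0 : 0 ≤ η) (h1 : η ≤ 1) (R : Classifier X → ℝ)
    (f : Classifier X → ℝ) : expectation (mixture hH h0 h1 R) f =
      ∑ i, mixtureWeight H η R i * f (mixtureClassifier H i) := by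
  rw [mixture, expectation_bind (B := ∑ i, |f (mixtureClassifier H i)|)]
  · simp only [expectation_pure]
    rw [expectation, tsum_fintype]
    refine Finset.sum_congr rfl fun i _ => ?_
    rw [PMF.ofFintype_apply, ENNReal.toReal_ofReal (mixtureWeight_nonneg hH h0 h1 R i)]
  · intro i _ b hb
    rw [PMF.support_pure, Set.mem_singleton_iff] at hb
    rw [hb]
    exact Finset.single_le_sum (f := fun i => |f (mixtureClassifier H i)|)
      (fun _ _ => abs_nonneg _) (Finset.mem_univ i)

/-- Exponential weights on the importance-weighted estimates, mixed with the all-negative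
classifier. -/
def exponentialWeights (hH : H.Nonempty) (h0 : 0 ≤ η) (h1 : η ≤ 1) : Learner X :=
  fun obs => mixture hH h0 h1 (estimatedLosses G H η obs)

theorem le_rejectionProb (hH : H.Nonempty) (h1 : η ≤ 1) (R : Classifier X → ℝ) (x : X) :
    η ≤ rejectionProb G H η R x :=
  le_add_of_nonneg_right (mul_nonneg (sub_nonneg.2 h1) (weightedRejection_nonneg G hH R x))

theorem estimatedLosses_concat (obs : List (Observation X)) (o : Observation X) :
    estimatedLosses G H η (obs ++ [o]) = updateLosses G H η (estimatedLosses G H η obs) o := by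
  simp [estimatedLosses]

/-- A crude bound, needed only so that expectations of the potential are summable; it does not enter
the rate. -/
theorem abs_estimatedLosses_le (hH : H.Nonempty) (h0 : 0 < η) (h1 : η ≤ 1)
    (obs : List (Observation X)) (h : Classifier X) :
    |estimatedLosses G H η obs h| ≤ obs.length / η := by
  induction obs using List.reverseRecOn with
  | nil => simp [estimatedLosses]
  | append_singleton l o ih =>
    rw [estimatedLosses_concat, List.length_append, List.length_singleton, Nat.cast_add, add_div,
      updateLosses]
    refine (abs_add_le _ _).trans (add_le_add ih ?_)
    split_ifs
    · simpa using h0.le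
    · have hq := le_rejectionProb G hH h1 (estimatedLosses G H η l) o.manipulated
      rw [abs_div, abs_mul, abs_labelSign, one_mul, abs_of_nonneg (rejection_nonneg _ _),
        abs_of_pos (h0.trans_le hq), Nat.cast_one]
      exact div_le_div₀ zero_le_one (rejection_le_one _ _) h0 hq

theorem exp_le_totalWeight {h : Classifier X} (hh : h ∈ H) (R : Classifier X → ℝ) :
    Real.exp (-η * R h) ≤ totalWeight H η R :=
  Finset.single_le_sum (f := fun h => Real.exp (-η * R h)) (fun _ _ => (Real.exp_pos _).le) hh

theorem neg_le_log_totalWeight {h : Classifier X} (hh : h ∈ H) (R : Classifier X → ℝ) :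
    -η * R h ≤ Real.log (totalWeight H η R) :=
  (Real.le_log_iff_exp_le (totalWeight_pos ⟨h, hh⟩ R)).2 (exp_le_totalWeight hh R)

/-- The comparator is one summand of the partition function. Regret is thus at most regret plus
potential, the quantity whose drift is controlled. -/
theorem potential_nonneg (h0 : 0 < η) {h : Classifier X} (hh : h ∈ H) (R : Classifier X → ℝ) :
    0 ≤ potential H η h R := by
  have h2 := div_le_div_of_nonneg_right (neg_le_log_totalWeight (η := η) hh R) h0.le
  rw [show -η * R h / η = -R h by field_simp] at h2
  unfold potential
  linarith

theorem potential_le (h0 : 0 < η) {h : Classifier X} (hh : h ∈ H) {R : Classifier X → ℝ} {K : ℝ}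
    (hR : ∀ h, |R h| ≤ K) : potential H η h R ≤ Real.log H.card / η + 2 * K := by
  have hn : (0 : ℝ) < H.card := by exact_mod_cast Finset.card_pos.2 ⟨h, hh⟩
  have h2 : totalWeight H η R ≤ H.card * Real.exp (η * K) := by
    rw [← nsmul_eq_mul]
    refine Finset.sum_le_card_nsmul _ _ _ fun g _ => Real.exp_le_exp.2 ?_
    nlinarith [(abs_le.1 (hR g)).1]
  have h3 := Real.log_le_log (totalWeight_pos ⟨h, hh⟩ R) h2
  rw [Real.log_mul hn.ne' (Real.exp_ne_zero _), Real.log_exp] at h3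
  have h4 := div_le_div_of_nonneg_right h3 h0.le
  rw [add_div, show η * K / η = K by field_simp] at h4
  unfold potential
  linarith [(abs_le.1 (hR h)).2]

theorem potential_zero (h : Classifier X) : potential H η h 0 = Real.log H.card / η := by
  simp [potential, totalWeight]

/-- If the estimated losses increase by `u` on the classifiers that reject `x`, then the logarithm
of the total weight increases by at most `weightedRejection * (exp (-η * u) - 1)`. -/
theorem log_totalWeight_le (hH : H.Nonempty) (R R' : Classifier X → ℝ) (x : X) (u : ℝ)
    (hR : ∀ h, R' h = R h + u * rejection G h x) :
    Real.log (totalWeight H η R') ≤ Real.log (totalWeight H η R) +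
      weightedRejection G H η R x * (Real.exp (-η * u) - 1) := by
  have hW := totalWeight_pos (η := η) hH R
  have hW' := totalWeight_pos (η := η) hH R'
  have hratio : totalWeight H η R' / totalWeight H η R =
      weightedRejection G H η R x * (Real.exp (-η * u) - 1) + 1 := by
    conv_rhs => enter [2]; rw [← sum_weights_eq_one (η := η) hH R]
    rw [weightedRejection, Finset.sum_mul, ← Finset.sum_add_distrib]
    conv_lhs => rw [totalWeight, Finset.sum_div]
    refine Finset.sum_congr rfl fun h _ => ?_
    rw [hR h, mul_add, Real.exp_add]
    -- For `r` in `{0, 1}`, `exp (-η * u * r) = 1 + r * (exp (-η * u) - 1)` exactly.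
    rcases rejection_eq_zero_or_one (G := G) h x with h | h <;> rw [h]
    · simp
    · rw [mul_one]
      ring
  have := Real.log_le_sub_one_of_pos (div_pos hW' hW)
  rw [Real.log_div hW'.ne' hW.ne', hratio] at this
  linarith

/-- The expected one-round increase of regret plus potential, for a fixed agent. -/
theorem drift_le (hH : H.Nonempty) (h0 : 0 < η) (h1 : η ≤ 1 / 2) (ρ : ManipulationRule G)
    (R : Classifier X → ℝ) (g : Classifier X) (a : Agent X) :
    expectation (mixture hH h0.le (h1.trans (by norm_num)) R) (fun h =>
      strategicLoss ρ h a - strategicLoss ρ g a +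
        potential H η g (updateLosses G H η R (Round.observe ⟨h, a, ρ.move h a.1⟩))) ≤
      potential H η g R + 3 * η := by
  have hη1 : η ≤ 1 := h1.trans (by norm_num)
  obtain ⟨x, y⟩ := a
  set s := labelSign y with hs
  set q := rejectionProb G H η R x with hq
  set p := weightedRejection G H η R x with hp
  have hηq : η ≤ q := le_rejectionProb G hH hη1 R x
  have hq0 : 0 < q := h0.trans_le hηq
  have hp0 : 0 ≤ p := weightedRejection_nonneg G hH R x
  have hp1 : p ≤ 1 := weightedRejection_le_one G hH R x
  have hqp : q = η + (1 - η) * p := rfl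
  have hs1 : |s| = 1 := abs_labelSign y
  -- An upper bound for the change of the potential when `x` is rejected; otherwise the potential is
  -- unchanged.
  set D := p * (Real.exp (-η * (s / q)) - 1) / η + s * rejection G g x / q with hD
  have hpoint : ∀ h, strategicLoss ρ h (x, y) - strategicLoss ρ g (x, y) +
      potential H η g (updateLosses G H η R (Round.observe ⟨h, (x, y), ρ.move h x⟩)) ≤
      rejection G h x * (s + D) + (potential H η g R - s * rejection G g x) := fun h => by
    rw [strategicLoss_eq, strategicLoss_eq]
    by_cases hx : bestResponses G h x = ∅
    · have hr : rejection G h x = 1 := if_pos hx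
      have hfalse := apply_move_eq_false_of_empty ρ hx
      rw [move_eq_self_of_empty ρ hx] at hfalse ⊢
      have hupd : ∀ f, updateLosses G H η R (Round.observe ⟨h, (x, y), x⟩) f =
          R f + s / q * rejection G f x := fun f => by
        simp only [updateLosses, Round.observe, hfalse, Bool.false_eq_true, if_false, ← hs, ← hq]
        ring
      have hlog := div_le_div_of_nonneg_right
        (log_totalWeight_le G (η := η) hH R _ x (s / q) hupd) h0.le
      rw [add_div] at hlog
      rw [potential, potential, hupd g, hr, hD]
      have : s / q * rejection G g x = s * rejection G g x / q := by ring
      simp only [← hs]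
      linarith
    · have hr : rejection G h x = 0 := if_neg hx
      have hupd : updateLosses G H η R (Round.observe ⟨h, (x, y), ρ.move h x⟩) = R := by
        funext f
        simp [updateLosses, Round.observe, apply_move_eq_true_of_nonempty ρ hx]
      rw [hupd, hr]
      simp only [← hs]
      linarith
  rw [expectation_mixture]
  calc _ ≤ ∑ i, mixtureWeight H η R i * (rejection G (mixtureClassifier H i) x * (s + D) +
        (potential H η g R - s * rejection G g x)) :=
        Finset.sum_le_sum fun i _ => mul_le_mul_of_nonneg_left (hpoint _)
          (mixtureWeight_nonneg hH h0.le hη1 R i)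
    _ = q * (s + D) + (potential H η g R - s * rejection G g x) := by
        simp only [mul_add, ← mul_assoc, Finset.sum_add_distrib, ← Finset.sum_mul,
          sum_mixtureWeight_mul_rejection, sum_mixtureWeight hH]
        ring
    _ ≤ potential H η g R + 3 * η := by
        have hu : |-η * (s / q)| = η / q := by
          rw [abs_mul, abs_neg, abs_div, hs1, abs_of_pos h0, abs_of_pos hq0]
          ring
        -- `|exp v - 1 - v| ≤ v ^ 2` requires `|v| ≤ 1`; here `|v| = η / q ≤ 1` thanks to
        -- exploration.
        have hexp := Real.abs_exp_sub_one_sub_id_le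
          (show |-η * (s / q)| ≤ 1 by rw [hu]; exact (div_le_one hq0).2 hηq)
        rw [← sq_abs (-η * (s / q)), hu] at hexp
        have hexp' : Real.exp (-η * (s / q)) - 1 ≤ -η * (s / q) + (η / q) ^ 2 := by
          linarith [(abs_le.1 hexp).2]
        -- Since `η ≤ 1 / 2`, `q ≥ (1 - η) * p ≥ p / 2`.
        have hpq : p / q ≤ 2 := by
          rw [div_le_iff₀ hq0]
          nlinarith
        have h3 : q * (p * (Real.exp (-η * (s / q)) - 1) / η) ≤ -(s * p) + η * (p / q) := by
          calc q * (p * (Real.exp (-η * (s / q)) - 1) / η)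
              = q * p / η * (Real.exp (-η * (s / q)) - 1) := by ring
            _ ≤ q * p / η * (-η * (s / q) + (η / q) ^ 2) :=
                mul_le_mul_of_nonneg_left hexp' (by positivity)
            _ = -(s * p) + η * (p / q) := by field_simp
        have h4 : q * D = q * (p * (Real.exp (-η * (s / q)) - 1) / η) + s * rejection G g x := by
          rw [hD]
          field_simp
        -- The cost of exploration: `q - p = η * (1 - p)`. Together with the second-order term `2 *
        -- η` it yields the constant `3`.
        have h5 : s * (q - p) ≤ η := by
          have : s * (q - p) ≤ |s * (q - p)| := le_abs_self _
          rw [abs_mul, hs1, one_mul, abs_of_nonneg (by rw [hqp]; nlinarith)] at this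
          nlinarith
        nlinarith

/-- The regret bound of exponential weights with exploration rate `η`. -/
theorem expectation_regretAgainst_exponentialWeights_le (hH : H.Nonempty) (h0 : 0 < η)
    (h1 : η ≤ 1 / 2) (ρ : ManipulationRule G) (A : Adversary X) {g : Classifier X} (hg : g ∈ H)
    (T : ℕ) :
    expectation
      (play ρ (exponentialWeights G hH h0.le (h1.trans (by norm_num))) A T) (regretAgainst ρ g) ≤
      Real.log H.card / η + T * (3 * η) := by
  have hη1 : η ≤ 1 := h1.trans (by norm_num)
  set F : List (Round X) → ℝ := fun l => regretAgainst ρ g l +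
    potential H η g (estimatedLosses G H η (l.map Round.observe)) with hF
  set B : ℕ → ℝ := fun k => k + (Real.log H.card / η + 2 * (k / η))
  have hB : ∀ l, |F l| ≤ B l.length := fun l => by
    have h2 := potential_le (η := η) h0 hg fun h =>
      abs_estimatedLosses_le G hH h0 hη1 (l.map Round.observe) h
    rw [List.length_map] at h2
    refine (abs_add_le _ _).trans (add_le_add (abs_regretAgainst_le ρ g l) ?_)
    rwa [abs_of_nonneg (potential_nonneg h0 hg _)]
  have hlen := length_of_mem_support_play ρ (exponentialWeights G hH h0.le hη1) A T
  calc _ ≤ expectation (play ρ (exponentialWeights G hH h0.le hη1) A T) F :=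
        expectation_mono _ (B := T) (B' := B T)
          (fun l hl => by simpa [hlen l hl] using abs_regretAgainst_le ρ g l)
          (fun l hl => by simpa [hlen l hl] using hB l)
          (fun l _ => le_add_of_nonneg_right (potential_nonneg h0 hg _))
    _ ≤ F [] + T * (3 * η) := by
        refine expectation_play_le ρ _ A hB (fun past a => ?_) T
        have hd := drift_le G hH h0 h1 ρ
          (estimatedLosses G H η (past.map Round.observe)) g a
        have hcongr : (fun h => F (past ++ [⟨h, a, ρ.move h a.1⟩])) = fun h =>
            strategicLoss ρ h a - strategicLoss ρ g a +
            potential H η g (updateLosses G H η (estimatedLosses G H η (past.map Round.observe))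
              (Round.observe ⟨h, a, ρ.move h a.1⟩)) + regretAgainst ρ g past := by
          funext h
          simp only [hF, regretAgainst_concat, List.map_append, List.map_cons, List.map_nil,
            estimatedLosses_concat]
          ring
        -- The mixture is finite, so the past regret, constant in `h`, comes out of a finite sum.
        rw [exponentialWeights, hcongr, expectation_mixture]
        rw [expectation_mixture] at hd
        simp only [mul_add _ _ (regretAgainst ρ g past), Finset.sum_add_distrib,
          ← Finset.sum_mul, sum_mixtureWeight hH, one_mul, hF]
        linarith
    _ = Real.log H.card / η + T * (3 * η) := by
        simp only [hF, regretAgainst_nil, List.map_nil, zero_add]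
        rw [show estimatedLosses G H η [] = 0 from rfl, potential_zero]

end ExponentialWeights

/-! ### The choice of the learner -/

/-- Some learner has expected regret at most `4 * √(T * log n)`. -/
theorem exists_learner_regret_le (G : Digraph X) (H : Finset (Classifier X)) (hH : H.Nonempty)
    {T : ℕ} (hT : 1 ≤ T) : ∃ L : Learner X, ∀ (ρ : ManipulationRule G) (A : Adversary X),
      ∀ g ∈ H, expectation (play ρ L A T) (regretAgainst ρ g) ≤
        4 * Real.sqrt (T * Real.log H.card) := by
  have hT0 : (0 : ℝ) < T := by exact_mod_cast hT
  have hn : (1 : ℝ) ≤ H.card := by exact_mod_cast Finset.card_pos.2 hH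
  rcases (Real.log_nonneg hn).eq_or_lt with hlog | hlog
  -- If `log n = 0` the rate `η` would vanish, but then the class is a singleton and playing its
  -- only member has no regret.
  · obtain ⟨h, hh⟩ := hH
    have hcard : H.card ≤ 1 := by
      by_contra! hc
      exact (Real.log_pos (by exact_mod_cast hc)).ne hlog
    refine ⟨fun _ => PMF.pure h, fun ρ A g hg => ?_⟩
    rw [Finset.card_le_one.1 hcard g hg h hh, ← hlog]
    simpa using expectation_regretAgainst_pure_le ρ A h T
  · set K := Real.log H.card
    -- This balances the two terms: `K / η = T * η = √(T * K)`, so the total is `(1 + 3) * √(T *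
    -- K)`.
    set η := Real.sqrt (K / T) with hη
    have h0 : 0 < η := Real.sqrt_pos.2 (div_pos hlog hT0)
    have hsq : η ^ 2 = K / T := Real.sq_sqrt (div_pos hlog hT0).le
    have hK : K = T * η ^ 2 := by rw [hsq]; field_simp
    have hroot : Real.sqrt (T * K) = T * η := by
      rw [hK, show (T : ℝ) * (T * η ^ 2) = (T * η) ^ 2 by ring, Real.sqrt_sq (by positivity)]
    by_cases h1 : η ≤ 1 / 2
    · refine ⟨_, fun ρ A g hg =>
        (expectation_regretAgainst_exponentialWeights_le G hH h0 h1 ρ A hg T).trans (le_of_eq ?_)⟩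
      change K / η + _ = _
      rw [hroot, hK]
      field_simp
      ring
    -- When `η > 1 / 2`, `T ≤ 4 * T * η`, so the trivial bound suffices and the choice of learner is
    -- immaterial.
    · refine ⟨fun _ => PMF.pure fun _ => false, fun ρ A g _ =>
        (expectation_regretAgainst_le_horizon ρ _ A g T).trans ?_⟩
      rw [hroot]
      nlinarith

/-- A quantity below both `T` and `4 * √(T * K)` is at most of order `T ^ (3 / 4) * K ^ (1 / 4)`. -/
theorem le_rpow_mul_rpow {T K r : ℝ} (hT : 0 ≤ T) (hK : 0 ≤ K) (h1 : r ≤ T)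
    (h2 : r ≤ 4 * Real.sqrt (T * K)) : r ≤ 4 * (T ^ (3 / 4 : ℝ) * K ^ (1 / 4 : ℝ)) := by
  rcases le_total K T with h | h
  · refine h2.trans (mul_le_mul_of_nonneg_left ?_ (by norm_num))
    calc Real.sqrt (T * K) = T ^ (1 / 2 : ℝ) * (K ^ (1 / 4 : ℝ) * K ^ (1 / 4 : ℝ)) := by
          rw [Real.sqrt_eq_rpow, Real.mul_rpow hT hK, ← Real.rpow_add_of_nonneg hK] <;> norm_num
      -- Only one of the two factors `K ^ (1 / 4)` is traded for `T ^ (1 / 4)`, using `K ≤ T`.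
      _ ≤ T ^ (1 / 2 : ℝ) * (T ^ (1 / 4 : ℝ) * K ^ (1 / 4 : ℝ)) := by gcongr
      _ = T ^ (3 / 4 : ℝ) * K ^ (1 / 4 : ℝ) := by
          rw [← mul_assoc, ← Real.rpow_add_of_nonneg hT] <;> norm_num
  · calc r ≤ T := h1
      _ = T ^ (3 / 4 : ℝ) * T ^ (1 / 4 : ℝ) := by
          rw [← Real.rpow_add_of_nonneg hT] <;> norm_num
      _ ≤ T ^ (3 / 4 : ℝ) * K ^ (1 / 4 : ℝ) := by gcongr
      _ ≤ 4 * (T ^ (3 / 4 : ℝ) * K ^ (1 / 4 : ℝ)) := by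
          have : 0 ≤ T ^ (3 / 4 : ℝ) * K ^ (1 / 4 : ℝ) := by positivity
          linarith

end

end OnlineStrategic

theorem mainTheorem9 :
    ∃ C : ℝ, 0 < C ∧
      ∀ (X : Type*) (G : Digraph X)
        (H : Finset (OnlineStrategic.Classifier X)) (hH : H.Nonempty) (T : ℕ), 1 ≤ T →
        ∃ L : OnlineStrategic.Learner X,
          ∀ (ρ : OnlineStrategic.ManipulationRule G) (A : OnlineStrategic.Adversary X),
            OnlineStrategic.expectedRegret ρ H hH L A T ≤
              C * min
                (Real.sqrt (T * Real.log H.card) + H.card * Real.log (H.card * T))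
                ((T : ℝ) ^ (3 / 4 : ℝ) * Real.log (H.card * T) ^ (1 / 4 : ℝ)) := by
  refine ⟨4, by norm_num, fun X G H hH T hT => ?_⟩
  obtain ⟨L, hL⟩ := OnlineStrategic.exists_learner_regret_le G H hH hT
  refine ⟨L, fun ρ A => Finset.sup'_le _ _ fun g hg => ?_⟩
  have hT1 : (1 : ℝ) ≤ T := by exact_mod_cast hT
  have hn : (1 : ℝ) ≤ H.card := by exact_mod_cast Finset.card_pos.2 hH
  have hlog : 0 ≤ Real.log H.card := Real.log_nonneg hn
  have hlog' : Real.log H.card ≤ Real.log (H.card * T) :=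
    Real.log_le_log (by linarith) (le_mul_of_one_le_right (by linarith) hT1)
  have hbound := hL ρ A g hg
  rw [mul_min_of_nonneg _ _ (by norm_num : (0 : ℝ) ≤ 4)]
  refine le_min (hbound.trans ?_) ?_
  -- The additive term `n * log (n * T)` is slack: only its nonnegativity is used.
  · have : 0 ≤ (H.card : ℝ) * Real.log (H.card * T) :=
      mul_nonneg (by linarith) (hlog.trans hlog')
    linarith
  · refine OnlineStrategic.le_rpow_mul_rpow (by linarith) (hlog.trans hlog')
      (OnlineStrategic.expectation_regretAgainst_le_horizon ρ L A g T) (hbound.trans ?_)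
    gcongr
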